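/- **Setting.** Let $C\subseteq\mathbb R$ be compact, let $\mathcal P$ be the set of Borel probability measures on $C$, and let a *risk functional* be any map $\rho:\mathcal P\to\mathbb R$. Let $\Delta^M=\{p\in[0,1]^{M+1}:\sum_{i=0}^M p_i=1\}$. For an alphabet $\mathcal S=\{s_0,\dots,s_M\}\subset C$ of $M+1$ distinct points, with $M\ge 1$, and $p\in\Delta^M$, put $\mathfrak D_{\mathcal S}(p)=\sum_{i=0}^M p_i\delta_{s_i}$, $\sigma_{\rho,\mathcal S}(p)=\rho(\mathfrak D_{\mathcal S}(p))$, $\mathcal P_{\mathcal S}=\mathfrak D_{\mathcal S}(\Delta^M)$, $\mathcal T_{\rho,\mathcal S}(r)=\{\eta\in\mathcal P_{\mathcal S}:\rho(\eta)\ge r\}$ and $$\mathcal K_{\inf}^{\rho_{\mathcal S}}(\mu,r)=\inf\{\mathrm{KL}(\mu,\eta):\eta\in\mathcal T_{\rho,\mathcal S}(r)\}\in[0,\infty]\qquad(\inf\emptyset=\infty).$$ For $I\subseteq\{0,\dots,M\}$ let $\mathcal T^{(2)}_{\mathcal S,p}(I)$ be the set of all $\mathfrak D_{\mathcal S}(q)$,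 $q\in\Delta^M$, with $q_i\le p_i$ for $i\in I$ and $q_i\ge p_i$ for $i\notin I$. Given $\mathcal S$, $r$ and $p\in\Delta^M$, a *dominance witness* is a pair $(p_*,I)$ with $p_*\in\Delta^M$ and $\emptyset\ne I\subsetneq\{0,\dots,M\}$ such that $\sigma_{\rho,\mathcal S}(p_*)\ge r$, $\mathcal K_{\inf}^{\rho_{\mathcal S}}(\mathfrak D_{\mathcal S}(p),r)=\mathrm{KL}(\mathfrak D_{\mathcal S}(p),\mathfrak D_{\mathcal S}(p_*))$, and $\rho(\eta)\ge\sigma_{\rho,\mathcal S}(p_*)$ for all $\eta\in\mathcal T^{(2)}_{\mathcal S,p_*}(I)$. The functional $\rho$ is *dominant* if a dominance witness exists for every finite alphabet $\mathcal S\subset C$ with at least two letters, every $r\in\mathbb R$ with $\mathcal T_{\rho,\mathcal S}(r)\neq\emptyset$, and every $p\in\Delta^M$ (where $M+1=|\mathcal S|$). **Lemma.** Let $M\ge1$ and $\varepsilon>0$. There is $N=N(M,\varepsilon)$ such that the following holds. Let $\mathcal S\subset C$ be an alphabet of size $M+1$, let $r\in\mathbb R$, and let $\rho$ be a dominant risk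 functional such that, for this $\mathcal S$ and $r$ (if $\mathcal T_{\rho,\mathcal S}(r)\ne\emptyset$) and for every element of $\Delta^M$, the dominance witness can be chosen with $|I|=M$. Let $\alpha\in\{1,2,\dots\}^{M+1}$, $n=\sum_{i=0}^M\alpha_i$ and $p=\alpha/n$, with $n\ge N$ and $p_i\ge\varepsilon$ for all $i$. Then for $L\sim\mathrm{Dir}(\alpha)$, $$\mathbb P\big(\sigma_{\rho,\mathcal S}(L)\ge r\big)\ \ge\ C_2\,n^{-\frac{M+1}{2}}\exp\!\big(-n\,\mathcal K_{\inf}^{\rho_{\mathcal S}}(\mathfrak D_{\mathcal S}(p),r)\big),\qquad C_2=\sqrt{2\pi}\,\Big(\frac{M}{2.13}\Big)^{M/2},$$ with $e^{-\infty}=0$. In particular, for fixed $p$ in the interior of $\Delta^M$ and $\alpha=np$, the bound holds for all sufficiently large $n$. -/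

import Mathlib

open MeasureTheory ProbabilityTheory InformationTheory
open scoped ENNReal

/-- A risk functional on the Borel probability measures on `C ⊆ ℝ`. No regularity is assumed. -/
abbrev RiskFunctional (C : Set ℝ) : Type := ProbabilityMeasure C → ℝ

/-- The probability measure `∑ i, p i • δ_{s i}` on `C`, for an alphabet `s 0, …, s M` in `C` and a
probability vector `p`. -/
noncomputable def discreteLaw {C : Set ℝ} {M : ℕ} (s : Fin (M + 1) → C)
    (p : stdSimplex ℝ (Fin (M + 1))) : ProbabilityMeasure C :=
  ⟨∑ i, ENNReal.ofReal (p i) • Measure.dirac (s i), ⟨by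
    simp only [Measure.finsetSum_apply, Measure.smul_apply, measure_univ, smul_eq_mul, mul_one]
    have h0 : ∀ i ∈ Finset.univ, 0 ≤ p i := fun i _ => p.2.1 i
    rw [← ENNReal.ofReal_sum_of_nonneg h0]
    exact (congrArg ENNReal.ofReal p.2.2).trans ENNReal.ofReal_one⟩⟩

/-- The risk functional read on probability vectors: `p ↦ ρ (∑ i, p i • δ_{s i})`. -/
noncomputable def simplexRisk {C : Set ℝ} {M : ℕ} (ρ : RiskFunctional C) (s : Fin (M + 1) → C)
    (p : stdSimplex ℝ (Fin (M + 1))) : ℝ :=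
  ρ (discreteLaw s p)

/-- The laws supported on the alphabet whose risk is at least `r`. -/
def riskSuperlevel {C : Set ℝ} {M : ℕ} (ρ : RiskFunctional C) (s : Fin (M + 1) → C) (r : ℝ) :
    Set (ProbabilityMeasure C) :=
  {η | η ∈ Set.range (discreteLaw s) ∧ r ≤ ρ η}

/-- The infimum of `KL(μ, η)` over the laws `η` on the alphabet with `r ≤ ρ η`;
it is `∞` if there is no such `η`. -/
noncomputable def riskKinf {C : Set ℝ} {M : ℕ} (ρ : RiskFunctional C) (s : Fin (M + 1) → C)
    (μ : ProbabilityMeasure C) (r : ℝ) : ℝ≥0∞ :=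
  ⨅ η ∈ riskSuperlevel ρ s r, klDiv (μ : Measure C) (η : Measure C)

/-- The laws `∑ i, q i • δ_{s i}` with `q i ≤ p i` for `i ∈ I` and `p i ≤ q i` for `i ∉ I`. -/
def simplexCone {C : Set ℝ} {M : ℕ} (s : Fin (M + 1) → C) (p : stdSimplex ℝ (Fin (M + 1)))
    (I : Finset (Fin (M + 1))) : Set (ProbabilityMeasure C) :=
  {η | ∃ q : stdSimplex ℝ (Fin (M + 1)), η = discreteLaw s q ∧
    (∀ i ∈ I, q i ≤ p i) ∧ ∀ i, i ∉ I → p i ≤ q i}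

/-- The law of `pstar` attains the infimum for the law of `p` at level `r`, and `I` is a nonempty
proper set of indices such that the risk on the corresponding cone at `pstar` is at least
the risk at `pstar`. -/
structure IsDominanceWitness {C : Set ℝ} {M : ℕ} (ρ : RiskFunctional C) (s : Fin (M + 1) → C)
    (r : ℝ) (p pstar : stdSimplex ℝ (Fin (M + 1))) (I : Finset (Fin (M + 1))) : Prop where
  feasible : discreteLaw s pstar ∈ riskSuperlevel ρ s r
  attains : riskKinf ρ s (discreteLaw s p) r =
    klDiv (discreteLaw s p : Measure C) (discreteLaw s pstar : Measure C)
  nonempty : I.Nonempty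
  ne_univ : I ≠ Finset.univ
  cone_subset : simplexCone s pstar I ⊆ riskSuperlevel ρ s (simplexRisk ρ s pstar)

/-- A risk functional is dominant if every alphabet of at least two letters, every level `r` that
some law on the alphabet reaches, and every `p` have a dominance witness. -/
def IsDominant {C : Set ℝ} (ρ : RiskFunctional C) : Prop :=
  ∀ (M : ℕ), 1 ≤ M → ∀ s : Fin (M + 1) → C, Function.Injective s →
    ∀ r : ℝ, (riskSuperlevel ρ s r).Nonempty → ∀ p : stdSimplex ℝ (Fin (M + 1)),
      ∃ (pstar : stdSimplex ℝ (Fin (M + 1))) (I : Finset (Fin (M + 1))),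
        IsDominanceWitness ρ s r p pstar I

/-- On the given alphabet and at the given level, the witness of dominance can be chosen with an
index set of `k` elements. -/
def HasDominanceCard {C : Set ℝ} {M : ℕ} (ρ : RiskFunctional C) (s : Fin (M + 1) → C) (r : ℝ)
    (k : ℕ) : Prop :=
  (riskSuperlevel ρ s r).Nonempty → ∀ p : stdSimplex ℝ (Fin (M + 1)),
    ∃ (pstar : stdSimplex ℝ (Fin (M + 1))) (I : Finset (Fin (M + 1))),
      IsDominanceWitness ρ s r p pstar I ∧ I.card = k

/-- The density `Γ(∑ α i) / ∏ Γ(α i) * ∏ x i ^ (α i - 1)` on the open simplex. -/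
noncomputable def dirichletDensity {M : ℕ} (α : Fin (M + 1) → ℝ) (x : Fin (M + 1) → ℝ) : ℝ :=
  Real.Gamma (∑ i, α i) / (∏ i, Real.Gamma (α i)) * ∏ i, x i ^ (α i - 1)

/-- The parametrisation `(x 1, …, x M) ↦ (1 - ∑ x i, x 1, …, x M)` of the hyperplane of vectors
with coordinate sum one. -/
def simplexChart {M : ℕ} (x : Fin M → ℝ) : Fin (M + 1) → ℝ := Fin.cons (1 - ∑ i, x i) x

open Classical in
/-- The Dirichlet distribution: its density with respect to Lebesgue measure in the coordinates
`x 1, …, x M` is `dirichletDensity α` on the open simplex and zero elsewhere. -/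
noncomputable def dirichletMeasure {M : ℕ} (α : Fin (M + 1) → ℝ) : Measure (Fin (M + 1) → ℝ) :=
  ((volume : Measure (Fin M → ℝ)).withDensity fun x =>
    if ∀ i, 0 < simplexChart x i then ENNReal.ofReal (dirichletDensity α (simplexChart x))
    else 0).map simplexChart

/-! A witness with `M` indices leaves one free coordinate `j`. Since coordinates sum to one, its
cone at the minimiser `q` is just `x i ≤ q i` for `i ≠ j`. Eliminating coordinate `j` turns it into
a box, on which `x j ≥ q j`, and integrating the Dirichlet density there gives at least `α j / n`
times the multinomial probability of `α` under `q` (`le_dirichletMeasure_box`, `gamma_mul_prod_eq`).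
Changing `q` to `p = α / n` costs exactly `exp (-n KL(p, q))` (`exp_neg_mul_klDiv_discreteLaw`), and
by Stirling the multinomial probability of `α` under `p` is at least of order `n ^ (-M / 2)`
(`sqrt_le_multinomial`). As `α j / n ≥ ε`, this beats the claimed `n ^ (-(M + 1) / 2)` by a factor
of order `√n`, which absorbs every constant once `n` is large. -/

/-! ### The Dirichlet law in coordinates and its symmetry -/

theorem measurable_simplexChart {M : ℕ} : Measurable (simplexChart (M := M)) := by
  refine measurable_pi_iff.2 fun i => ?_
  refine Fin.cases ?_ (fun k => ?_) i
  · simp only [simplexChart, Fin.cons_zero]; fun_prop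
  · simp only [simplexChart, Fin.cons_succ]; fun_prop

theorem sum_simplexChart {M : ℕ} (x : Fin M → ℝ) : ∑ i, simplexChart x i = 1 := by
  simp [simplexChart, Fin.sum_univ_succ]

open Classical in
/-- The density of `dirichletMeasure α` in the chart `simplexChart`. -/
noncomputable def dirichletChartDensity {M : ℕ} (α : Fin (M + 1) → ℝ) (x : Fin M → ℝ) : ℝ≥0∞ :=
  if ∀ i, 0 < simplexChart x i then ENNReal.ofReal (dirichletDensity α (simplexChart x)) else 0

theorem measurable_dirichletChartDensity {M : ℕ} (α : Fin (M + 1) → ℝ) :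
    Measurable (dirichletChartDensity α) := by
  classical
  have h (i : Fin (M + 1)) : Measurable fun x : Fin M → ℝ => simplexChart x i :=
    (measurable_pi_apply i).comp measurable_simplexChart
  unfold dirichletChartDensity dirichletDensity
  refine Measurable.ite ?_ ?_ measurable_const
  · simp only [Set.ofPred_forall]
    exact MeasurableSet.iInter fun i => measurableSet_lt measurable_const (h i)
  · refine (Measurable.const_mul ?_ _).ennreal_ofReal
    exact Finset.measurable_prod _ fun i _ => (h i).pow_const _

theorem dirichletMeasure_apply {M : ℕ} (α : Fin (M + 1) → ℝ) {S : Set (Fin (M + 1) → ℝ)}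
    (hS : MeasurableSet S) :
    dirichletMeasure α S = ∫⁻ x in simplexChart ⁻¹' S, dirichletChartDensity α x := by
  rw [dirichletMeasure, Measure.map_apply measurable_simplexChart hS,
    withDensity_apply _ (measurable_simplexChart hS)]
  rfl

/-- The exchange of the eliminated coordinate `1 - ∑ i, x i` with the coordinate `x k`. -/
noncomputable def chartSwap {M : ℕ} (k : Fin M) (x : Fin M → ℝ) : Fin M → ℝ :=
  Function.update x k (1 - ∑ i, x i)

theorem simplexChart_chartSwap {M : ℕ} (k : Fin M) (x : Fin M → ℝ) (i : Fin (M + 1)) :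
    simplexChart (chartSwap k x) i = simplexChart x (Equiv.swap 0 k.succ i) := by
  refine Fin.cases ?_ (fun l => ?_) i
  · have : ∑ i, Function.update x k (1 - ∑ i, x i) i = 1 - x k := by
      rw [Finset.sum_update_of_mem (Finset.mem_univ k),
        ← Finset.add_sum_erase _ x (Finset.mem_univ k), Finset.sdiff_singleton_eq_erase]
      ring
    simp [simplexChart, chartSwap, this]
  · rcases eq_or_ne l k with rfl | hl
    · simp [simplexChart, chartSwap]
    · rw [Equiv.swap_apply_of_ne_of_ne (Fin.succ_ne_zero l) (by simpa using hl)]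
      simp [simplexChart, chartSwap, hl]

/-- The map is affine and its linear part `f` is an involution, so `det f = ±1`. -/
theorem measurePreserving_chartSwap {M : ℕ} (k : Fin M) :
    MeasurePreserving (chartSwap k) := by
  let f : (Fin M → ℝ) →ₗ[ℝ] (Fin M → ℝ) :=
    { toFun x := Function.update x k (-∑ i, x i)
      map_add' x y := by
        ext i
        rcases eq_or_ne i k with rfl | hi
        · simp [Finset.sum_add_distrib]; ring
        · simp [hi]
      map_smul' c x := by
        ext i
        rcases eq_or_ne i k with rfl | hi
        · simp [Finset.mul_sum]
        · simp [hi] }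
  have hff : f * f = 1 := by
    refine LinearMap.ext fun x => ?_
    change Function.update (Function.update x k (-∑ i, x i)) k
      (-∑ i, Function.update x k (-∑ i, x i) i) = x
    rw [Finset.sum_update_of_mem (Finset.mem_univ k), Function.update_idem,
      ← Finset.add_sum_erase _ x (Finset.mem_univ k), Finset.sdiff_singleton_eq_erase]
    ext i
    rcases eq_or_ne i k with rfl | hi
    · simp
    · simp [hi]
  have hdet : |LinearMap.det f| = 1 := by
    have h : LinearMap.det f * LinearMap.det f = 1 := by rw [← map_mul, hff, map_one]
    rcases mul_self_eq_one_iff.1 h with h | h <;> simp [h]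
  have hf : MeasurePreserving f := by
    refine ⟨(LinearMap.continuous_of_finiteDimensional f).measurable, ?_⟩
    rw [Real.map_linearMap_volume_pi_eq_smul_volume_pi (fun h => by simp [h] at hdet), abs_inv,
      hdet]
    simp
  have h := (measurePreserving_add_right volume (Pi.single k (1 : ℝ))).comp hf
  suffices heq : chartSwap k = (fun x => x + Pi.single k 1) ∘ f by rwa [heq]
  refine funext fun x => funext fun i => ?_
  rcases eq_or_ne i k with rfl | hi
  · simp [chartSwap, f]; ring
  · simp [chartSwap, f, hi]

theorem dirichletChartDensity_chartSwap {M : ℕ} (α : Fin (M + 1) → ℝ) (k : Fin M)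
    (x : Fin M → ℝ) :
    dirichletChartDensity α (chartSwap k x) =
      dirichletChartDensity (fun i => α (Equiv.swap 0 k.succ i)) x := by
  have h : (∀ i, 0 < simplexChart x (Equiv.swap 0 k.succ i)) ↔ ∀ i, 0 < simplexChart x i :=
    (Equiv.swap 0 k.succ).forall_congr_right (q := fun i => 0 < simplexChart x i)
  simp only [dirichletChartDensity, simplexChart_chartSwap, h]
  refine if_congr Iff.rfl (congrArg _ ?_) rfl
  simp only [dirichletDensity, simplexChart_chartSwap]
  rw [Equiv.sum_comp (Equiv.swap 0 k.succ) α,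
    Equiv.prod_comp (Equiv.swap 0 k.succ) fun i => Real.Gamma (α i),
    ← Equiv.prod_comp (Equiv.swap 0 k.succ) fun i => simplexChart x i ^ _]
  have hσ (i) : Equiv.swap 0 k.succ (Equiv.swap 0 k.succ i) = i := by simp
  simp only [hσ]

/-- The chart singles out coordinate `0`; this symmetry lets any coordinate play that role. -/
theorem dirichletMeasure_swap {M : ℕ} (α : Fin (M + 1) → ℝ) (k : Fin M)
    {S : Set (Fin (M + 1) → ℝ)} (hS : MeasurableSet S) :
    dirichletMeasure (fun i => α (Equiv.swap 0 k.succ i))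
      {q | (fun i => q (Equiv.swap 0 k.succ i)) ∈ S} = dirichletMeasure α S := by
  have hm : Measurable fun (q : Fin (M + 1) → ℝ) i => q (Equiv.swap 0 k.succ i) := by fun_prop
  rw [dirichletMeasure_apply _ hS, dirichletMeasure_apply _ (show MeasurableSet {q | _} from hm hS),
    ← (measurePreserving_chartSwap k).setLIntegral_comp_preimage (measurable_simplexChart hS)
      (measurable_dirichletChartDensity α)]
  simp only [dirichletChartDensity_chartSwap]
  congr 2
  ext x
  simp only [Set.mem_preimage, Set.mem_ofPred_eq]
  rw [← funext (simplexChart_chartSwap k x)]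

/-! ### Dirichlet probability of a box -/

theorem lintegral_pi_Ioo_prod_rpow {ι : Type*} [Fintype ι] (a β : ι → ℝ) (ha : ∀ i, 0 < a i)
    (hβ : ∀ i, 0 < β i) :
    ∫⁻ x in Set.univ.pi fun i => Set.Ioo 0 (a i), ENNReal.ofReal (∏ i, x i ^ (β i - 1)) =
      ENNReal.ofReal (∏ i, a i ^ β i / β i) := by
  have hint (i : ι) : IntegrableOn (fun y : ℝ => y ^ (β i - 1)) (Set.Ioo 0 (a i)) := by
    rw [← intervalIntegrable_iff_integrableOn_Ioo_of_le (ha i).le]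
    exact intervalIntegral.intervalIntegrable_rpow' (by linarith [hβ i])
  have hval (i : ι) : ∫ y in Set.Ioo 0 (a i), y ^ (β i - 1) = a i ^ β i / β i := by
    rw [← integral_Ioc_eq_integral_Ioo, ← intervalIntegral.integral_of_le (ha i).le,
      integral_rpow (Or.inl (by linarith [hβ i]))]
    simp [Real.zero_rpow (hβ i).ne']
  have hms : MeasurableSet (Set.univ.pi fun i => Set.Ioo 0 (a i)) :=
    MeasurableSet.univ_pi fun _ => measurableSet_Ioo
  rw [← ofReal_integral_eq_lintegral_ofReal]
  · rw [volume_pi, Measure.restrict_pi_pi,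
      integral_fintype_prod_eq_prod fun i (y : ℝ) => y ^ (β i - 1)]
    simp only [hval]
  · rw [volume_pi, Measure.restrict_pi_pi]
    exact Integrable.fintype_prod hint
  · filter_upwards [ae_restrict_mem hms] with x hx
    exact Finset.prod_nonneg fun i _ => Real.rpow_nonneg (hx i trivial).1.le _

/-- On the box the factor of the eliminated coordinate is at least its value at `a 0`, because `α 0
≥ 1`; the other factors integrate separately. The final `α 0` cancels the denominator that the
symmetric product has at index `0`. -/
theorem le_dirichletMeasure_box_zero {M : ℕ} (hM : 1 ≤ M) (α a : Fin (M + 1) → ℝ)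
    (hα : ∀ i, 1 ≤ α i) (ha : ∀ i, 0 < a i) (hsum : ∑ i, a i = 1) :
    ENNReal.ofReal (Real.Gamma (∑ i, α i) / (∏ i, Real.Gamma (α i)) *
        ((∏ i, a i ^ α i / α i) * α 0)) ≤
      dirichletMeasure α {q | ∀ i, i ≠ 0 → q i ≤ a i} := by
  have : Nonempty (Fin M) := ⟨⟨0, hM⟩⟩
  have hα0 (i) : 0 < α i := zero_lt_one.trans_le (hα i)
  have hS : MeasurableSet {q : Fin (M + 1) → ℝ | ∀ i, i ≠ 0 → q i ≤ a i} := by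
    simp only [Set.ofPred_forall]
    exact MeasurableSet.iInter fun i => MeasurableSet.iInter fun _ =>
      measurableSet_le (measurable_pi_apply i) measurable_const
  set c := Real.Gamma (∑ i, α i) / ∏ i, Real.Gamma (α i) with hc
  have hc0 : 0 ≤ c := div_nonneg
    (Real.Gamma_nonneg_of_nonneg (Finset.sum_nonneg fun i _ => (hα0 i).le))
    (Finset.prod_nonneg fun i _ => Real.Gamma_nonneg_of_nonneg (hα0 i).le)
  have ha1 : a 0 ≤ 1 := hsum ▸ Finset.single_le_sum (fun i _ => (ha i).le) (Finset.mem_univ 0)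
  set B : Set (Fin M → ℝ) := Set.univ.pi fun i => Set.Ioo 0 (a i.succ) with hB
  have hBm : MeasurableSet B := MeasurableSet.univ_pi fun _ => measurableSet_Ioo
  have hsub : B ⊆ simplexChart ⁻¹' {q | ∀ i, i ≠ 0 → q i ≤ a i} := by
    intro x hx i hi
    obtain ⟨l, rfl⟩ := Fin.exists_succ_eq_of_ne_zero hi
    simpa [simplexChart] using (hx l trivial).2.le
  -- Giving up one factor `a 0 ≤ 1` makes the bound a product of the same form over all indices.
  have hzero : a 0 ^ α 0 ≤ a 0 ^ (α 0 - 1) :=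
    Real.rpow_le_rpow_of_exponent_ge (ha 0) ha1 (by linarith)
  have hprod : 0 ≤ ∏ i : Fin M, a i.succ ^ α i.succ / α i.succ :=
    Finset.prod_nonneg fun i _ => div_nonneg (Real.rpow_nonneg (ha _).le _) (hα0 _).le
  calc ENNReal.ofReal (c * ((∏ i, a i ^ α i / α i) * α 0))
      ≤ ENNReal.ofReal (c * a 0 ^ (α 0 - 1)) *
          ENNReal.ofReal (∏ i : Fin M, a i.succ ^ α i.succ / α i.succ) := by
        rw [← ENNReal.ofReal_mul (mul_nonneg hc0 (Real.rpow_nonneg (ha 0).le _))]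
        refine ENNReal.ofReal_le_ofReal ?_
        rw [Fin.prod_univ_succ, mul_assoc c]
        refine mul_le_mul_of_nonneg_left ?_ hc0
        calc _ = a 0 ^ α 0 * ∏ i : Fin M, a i.succ ^ α i.succ / α i.succ := by
              have := (hα0 0).ne'
              field_simp
          _ ≤ _ := mul_le_mul_of_nonneg_right hzero hprod
    _ = ∫⁻ x in B, ENNReal.ofReal (c * a 0 ^ (α 0 - 1)) *
          ENNReal.ofReal (∏ i, x i ^ (α i.succ - 1)) := by
        rw [lintegral_const_mul, hB, lintegral_pi_Ioo_prod_rpow (fun i : Fin M => a i.succ)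
          (fun i => α i.succ) (fun i => ha i.succ) fun i => hα0 i.succ]
        fun_prop
    _ ≤ ∫⁻ x in B, dirichletChartDensity α x := by
        refine setLIntegral_mono' hBm fun x hx => ?_
        have hlt : a 0 < 1 - ∑ i, x i := by
          have : ∑ i, x i < ∑ i : Fin M, a i.succ :=
            Finset.sum_lt_sum_of_nonempty Finset.univ_nonempty fun i _ => (hx i trivial).2
          rw [Fin.sum_univ_succ] at hsum
          linarith
        have hpos : ∀ i, 0 < simplexChart x i := by
          refine Fin.cases ?_ fun l => ?_
          · simpa [simplexChart] using (ha 0).trans hlt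
          · simpa [simplexChart] using (hx l trivial).1
        rw [dirichletChartDensity, if_pos hpos, dirichletDensity, ← hc, Fin.prod_univ_succ,
          ← mul_assoc, ENNReal.ofReal_mul
            (mul_nonneg hc0 (Real.rpow_nonneg (hpos 0).le _))]
        simp only [simplexChart, Fin.cons_zero, Fin.cons_succ]
        gcongr
        exacts [(ha 0).le, sub_nonneg.2 (hα 0)]
    _ ≤ _ := by
        rw [dirichletMeasure_apply _ hS]
        exact lintegral_mono_set hsub

/-- The Dirichlet measure of the part of the simplex where all coordinates but one are at most
those of a given point. -/
theorem le_dirichletMeasure_box {M : ℕ} (hM : 1 ≤ M) (α a : Fin (M + 1) → ℝ)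
    (hα : ∀ i, 1 ≤ α i) (ha : ∀ i, 0 < a i) (hsum : ∑ i, a i = 1) (j : Fin (M + 1)) :
    ENNReal.ofReal (Real.Gamma (∑ i, α i) / (∏ i, Real.Gamma (α i)) *
        ((∏ i, a i ^ α i / α i) * α j)) ≤
      dirichletMeasure α {q | ∀ i, i ≠ j → q i ≤ a i} := by
  refine Fin.cases (le_dirichletMeasure_box_zero hM α a hα ha hsum) (fun k => ?_) j
  set σ : Equiv.Perm (Fin (M + 1)) := Equiv.swap 0 k.succ with hσ
  have hS : MeasurableSet {q : Fin (M + 1) → ℝ | ∀ i, i ≠ k.succ → q i ≤ a i} := by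
    simp only [Set.ofPred_forall]
    exact MeasurableSet.iInter fun i => MeasurableSet.iInter fun _ =>
      measurableSet_le (measurable_pi_apply i) measurable_const
  have h := le_dirichletMeasure_box_zero hM (fun i => α (σ i)) (fun i => a (σ i))
    (fun i => hα _) (fun i => ha _) ((Equiv.sum_comp σ a).trans hsum)
  rw [Equiv.sum_comp σ α, Equiv.prod_comp σ fun i => Real.Gamma (α i),
    Equiv.prod_comp σ fun i => a i ^ α i / α i, show σ 0 = k.succ from Equiv.swap_apply_left _ _]
    at h
  refine h.trans (le_of_eq ?_)
  rw [← dirichletMeasure_swap α k hS]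
  congr 1
  ext q
  simp only [Set.mem_ofPred_eq, ← hσ]
  constructor
  · intro hq i hi
    have := hq (σ i) fun h0 => hi (by rw [← Equiv.swap_apply_left 0 k.succ, ← hσ, ← h0]; simp [hσ])
    simpa [hσ] using this
  · intro hq i hi
    have := hq (σ i) fun h0 => hi (by
      rw [← Equiv.swap_apply_right 0 k.succ, ← hσ, ← h0]; simp [hσ])
    simpa [hσ] using this

/-! ### Divergence between laws on the alphabet -/

theorem coe_discreteLaw {C : Set ℝ} {M : ℕ} (s : Fin (M + 1) → C)
    (p : stdSimplex ℝ (Fin (M + 1))) :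
    (discreteLaw s p : Measure C) = ∑ i, ENNReal.ofReal (p i) • Measure.dirac (s i) := rfl

theorem discreteLaw_singleton {C : Set ℝ} {M : ℕ} {s : Fin (M + 1) → C}
    (hs : Function.Injective s) (p : stdSimplex ℝ (Fin (M + 1))) (i : Fin (M + 1)) :
    (discreteLaw s p : Measure C) {s i} = ENNReal.ofReal (p i) := by
  classical
  rw [coe_discreteLaw, Measure.finsetSum_apply, Finset.sum_eq_single i]
  · simp
  · intro k _ hk
    simp [hs.ne hk]
  · simp

theorem pos_of_klDiv_discreteLaw_ne_top {C : Set ℝ} {M : ℕ} {s : Fin (M + 1) → C}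
    (hs : Function.Injective s) {p q : stdSimplex ℝ (Fin (M + 1))} (hp : ∀ i, 0 < p i)
    (h : klDiv (discreteLaw s p : Measure C) (discreteLaw s q : Measure C) ≠ ∞)
    (i : Fin (M + 1)) : 0 < q i := by
  by_contra hq
  have h0 : (discreteLaw s q : Measure C) {s i} = 0 := by
    rw [discreteLaw_singleton hs, ENNReal.ofReal_eq_zero]
    exact not_lt.1 hq
  have := (klDiv_ne_top_iff.1 h).1 h0
  rw [discreteLaw_singleton hs, ENNReal.ofReal_eq_zero] at this
  exact this.not_gt (hp i)

theorem toReal_klDiv_discreteLaw {C : Set ℝ} {M : ℕ} {s : Fin (M + 1) → C}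
    (hs : Function.Injective s) {p q : stdSimplex ℝ (Fin (M + 1))} (hp : ∀ i, 0 < p i)
    (h : klDiv (discreteLaw s p : Measure C) (discreteLaw s q : Measure C) ≠ ∞) :
    (klDiv (discreteLaw s p : Measure C) (discreteLaw s q : Measure C)).toReal =
      ∑ i, p i * Real.log (p i / q i) := by
  have hq := pos_of_klDiv_discreteLaw_ne_top hs hp h
  have hac := (klDiv_ne_top_iff.1 h).1
  -- Both masses are one, so only the integral of the log-likelihood ratio remains.
  rw [toReal_klDiv_of_measure_eq hac (by simp)]
  set ν : Measure C := (discreteLaw s q : Measure C) with hν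
  set μ : Measure C := (discreteLaw s p : Measure C) with hμ
  -- Integrating the Radon–Nikodym derivative over an atom of mass `q i > 0` determines its value
  -- there.
  have hllr (i) : llr μ ν (s i) = Real.log (p i / q i) := by
    have h1 : μ.rnDeriv ν (s i) * ENNReal.ofReal (q i) = ENNReal.ofReal (p i) := by
      rw [← discreteLaw_singleton hs q, ← discreteLaw_singleton hs p,
        ← lintegral_singleton (μ := ν), Measure.setLIntegral_rnDeriv hac]
    have h2 := congrArg ENNReal.toReal h1
    rw [ENNReal.toReal_mul, ENNReal.toReal_ofReal (hq i).le, ENNReal.toReal_ofReal (hp i).le] at h2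
    rw [llr, ← h2, mul_div_cancel_right₀ _ (hq i).ne']
  rw [show ∫ x, llr μ ν x ∂μ =
    ∫ x, llr μ ν x ∂(∑ i, ENNReal.ofReal (p i) • Measure.dirac (s i)) from rfl,
    integral_finsetSum_measure]
  · refine Finset.sum_congr rfl fun i _ => ?_
    rw [integral_smul_measure, integral_dirac, hllr, ENNReal.toReal_ofReal (hp i).le, smul_eq_mul]
  · intro i _
    exact (integrable_dirac (by simp)).smul_measure ENNReal.ofReal_ne_top

theorem exp_neg_mul_klDiv_discreteLaw {C : Set ℝ} {M : ℕ} {s : Fin (M + 1) → C}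
    (hs : Function.Injective s) {p q : stdSimplex ℝ (Fin (M + 1))} (hp : ∀ i, 0 < p i)
    (h : klDiv (discreteLaw s p : Measure C) (discreteLaw s q : Measure C) ≠ ∞) {n : ℝ}
    {α : Fin (M + 1) → ℝ} (hα : ∀ i, α i = n * p i) :
    Real.exp (-(n * (klDiv (discreteLaw s p : Measure C) (discreteLaw s q : Measure C)).toReal)) *
      ∏ i, p i ^ α i = ∏ i, q i ^ α i := by
  have hq := pos_of_klDiv_discreteLaw_ne_top hs hp h
  rw [toReal_klDiv_discreteLaw hs hp h, Finset.mul_sum, ← Finset.sum_neg_distrib, Real.exp_sum,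
    ← Finset.prod_mul_distrib]
  refine Finset.prod_congr rfl fun i _ => ?_
  rw [Real.rpow_def_of_pos (hp i), Real.rpow_def_of_pos (hq i), ← Real.exp_add,
    Real.log_div (hp i).ne' (hq i).ne', hα]
  ring_nf

/-! ### Stirling bounds for multinomial weights -/

/-- The Stirling sequence decreases from its value `e / √2` at `1`. -/
theorem factorial_le_exp_mul_sqrt {k : ℕ} (hk : 0 < k) :
    (k.factorial : ℝ) ≤ Real.exp 1 * √k * (k / Real.exp 1) ^ k := by
  obtain ⟨m, rfl⟩ := Nat.exists_eq_succ_of_ne_zero hk.ne'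
  have h : Stirling.stirlingSeq (m + 1) ≤ Real.exp 1 / √2 := by
    simpa using Stirling.stirlingSeq'_antitone (Nat.zero_le m)
  rw [Stirling.stirlingSeq, div_le_iff₀ (by positivity)] at h
  refine h.trans (le_of_eq ?_)
  rw [Real.sqrt_mul (by norm_num)]
  have : √(2 : ℝ) ≠ 0 := by positivity
  field_simp

/-- A lower bound on the multinomial probability of the composition `α` under the proportions
`α i / n`. -/
theorem sqrt_le_multinomial {ι : Type*} [Fintype ι] {α : ι → ℕ} (hα : ∀ i, 0 < α i)
    {n : ℕ} (hn : n = ∑ i, α i) (hn0 : 0 < n) :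
    √(2 * Real.pi * n) / (Real.exp 1 ^ Fintype.card ι * √n ^ Fintype.card ι) ≤
      n.factorial * ∏ i, ((α i : ℝ) / n) ^ α i / (α i).factorial := by
  have hn' : (0 : ℝ) < n := by exact_mod_cast hn0
  have h1 (i : ι) : 1 / (Real.exp 1 * √n) * (Real.exp 1 / n) ^ α i ≤
      ((α i : ℝ) / n) ^ α i / (α i).factorial := by
    have hα' : (0 : ℝ) < α i := by exact_mod_cast hα i
    have hle : √(α i : ℝ) ≤ √n := by
      refine Real.sqrt_le_sqrt ?_
      exact_mod_cast hn ▸ Finset.single_le_sum (fun i _ => Nat.zero_le (α i)) (Finset.mem_univ i)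
    rw [le_div_iff₀ (by positivity)]
    calc 1 / (Real.exp 1 * √n) * (Real.exp 1 / n) ^ α i * (α i).factorial
        ≤ 1 / (Real.exp 1 * √n) * (Real.exp 1 / n) ^ α i *
          (Real.exp 1 * √n * (α i / Real.exp 1) ^ α i) := by
          refine mul_le_mul_of_nonneg_left ((factorial_le_exp_mul_sqrt (hα i)).trans ?_)
            (by positivity)
          gcongr
      _ = (Real.exp 1 / n * (α i / Real.exp 1)) ^ α i := by
          rw [mul_pow]
          field_simp
      _ = _ := by
          congr 1
          field_simp
  -- The exponents `α i` sum to `n`, so the powers `(e / n) ^ α i` cancel the `(n / e) ^ n` of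
  -- Stirling's bound for `n!`.
  calc √(2 * Real.pi * n) / (Real.exp 1 ^ Fintype.card ι * √n ^ Fintype.card ι)
      = √(2 * Real.pi * n) * (n / Real.exp 1) ^ n *
          ∏ i, (1 / (Real.exp 1 * √n) * (Real.exp 1 / n) ^ α i) := by
        rw [Finset.prod_mul_distrib, Finset.prod_pow_eq_pow_sum, ← hn, Finset.prod_const,
          Finset.card_univ]
        rw [div_pow, div_pow, div_pow, mul_pow, one_pow]
        field_simp
    _ ≤ _ := by
        refine mul_le_mul (Stirling.le_factorial_stirling n)
          (Finset.prod_le_prod (fun i _ => by positivity) fun i _ => h1 i) ?_ (by positivity)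
        exact Finset.prod_nonneg fun i _ => by positivity

theorem gamma_mul_prod_eq {ι : Type*} [Fintype ι] {α : ι → ℕ} (hα : ∀ i, 0 < α i)
    {n : ℕ} (hn : n = ∑ i, α i) (hn0 : 0 < n) (a : ι → ℝ) :
    Real.Gamma (∑ i, (α i : ℝ)) / (∏ i, Real.Gamma (α i)) * ∏ i, a i ^ (α i : ℝ) / α i =
      n.factorial / n * ∏ i, a i ^ α i / (α i).factorial := by
  have hG {k : ℕ} (hk : 0 < k) : (k.factorial : ℝ) = k * Real.Gamma k := by
    rw [← Real.Gamma_add_one (by positivity), Real.Gamma_nat_eq_factorial]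
  have hn' : (n : ℝ) ≠ 0 := by positivity
  rw [← Nat.cast_sum, ← hn, hG hn0, mul_div_cancel_left₀ _ hn', div_mul_eq_mul_div, mul_div_assoc,
    ← Finset.prod_div_distrib]
  congr 1
  refine Finset.prod_congr rfl fun i _ => ?_
  rw [hG (hα i), Real.rpow_natCast, div_div]

/-- The Dirichlet law with parameter `n • p` gives the cone at `q` with one free coordinate at
least the multinomial weight of `n • p` under `q`, up to a constant. -/
theorem le_dirichletMeasure_cone {M : ℕ} (hM : 1 ≤ M) {ε : ℝ} (hε : 0 < ε)
    {C : Set ℝ} {s : Fin (M + 1) → C} (hs : Function.Injective s)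
    {α : Fin (M + 1) → ℕ} (hα : ∀ i, 0 < α i) {n : ℕ} (hn : n = ∑ i, α i)
    (hN : Real.exp 1 ^ (M + 1) * ((M : ℝ) / 2.13) ^ ((M : ℝ) / 2) / ε ≤ √n)
    {p q : stdSimplex ℝ (Fin (M + 1))} (hpα : ∀ i, p i = (α i : ℝ) / n) (hpε : ∀ i, ε ≤ p i)
    (h : klDiv (discreteLaw s p : Measure C) (discreteLaw s q : Measure C) ≠ ∞)
    (j : Fin (M + 1)) :
    ENNReal.ofReal (√(2 * Real.pi) * ((M : ℝ) / 2.13) ^ ((M : ℝ) / 2) *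
          (n : ℝ) ^ (-((M : ℝ) + 1) / 2) *
        Real.exp (-(n * (klDiv (discreteLaw s p : Measure C)
          (discreteLaw s q : Measure C)).toReal))) ≤
      dirichletMeasure (fun i => (α i : ℝ)) {x | ∀ i, i ≠ j → x i ≤ q i} := by
  have hp (i) : 0 < p i := hε.trans_le (hpε i)
  have hq := pos_of_klDiv_discreteLaw_ne_top hs hp h
  have hn0 : 0 < n := hn ▸ (hα 0).trans_le
    (Finset.single_le_sum (fun i _ => Nat.zero_le (α i)) (Finset.mem_univ 0))
  have hn' : (0 : ℝ) < n := by exact_mod_cast hn0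
  refine le_trans (ENNReal.ofReal_le_ofReal ?_) (le_dirichletMeasure_box hM
    (fun i => (α i : ℝ)) q (fun i => by exact_mod_cast hα i) hq q.2.2 j)
  have hexp := exp_neg_mul_klDiv_discreteLaw hs hp h (n := n) (α := fun i => (α i : ℝ))
    fun i => by rw [hpα]; field_simp
  simp only [Real.rpow_natCast] at hexp
  set E := Real.exp (-(n * (klDiv (discreteLaw s p : Measure C)
    (discreteLaw s q : Measure C)).toReal))
  set A := ((M : ℝ) / 2.13) ^ ((M : ℝ) / 2)
  have hmult := sqrt_le_multinomial hα hn hn0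
  rw [Fintype.card_fin] at hmult
  have hpow : (n : ℝ) ^ (-((M : ℝ) + 1) / 2) = (√n ^ (M + 1))⁻¹ := by
    rw [← Real.rpow_natCast, Real.sqrt_eq_rpow, ← Real.rpow_mul hn'.le, ← Real.rpow_neg hn'.le]
    congr 1
    push_cast
    ring
  -- The `√n` in Stirling's bound for `n!` pays for `A`, `e ^ (M + 1)` and `1 / ε`; this is exactly
  -- `hN`.
  have hconst : √(2 * Real.pi) * A * (n : ℝ) ^ (-((M : ℝ) + 1) / 2) ≤
      √(2 * Real.pi * n) / (Real.exp 1 ^ (M + 1) * √n ^ (M + 1)) * ε := by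
    rw [div_le_iff₀ hε] at hN
    rw [hpow, Real.sqrt_mul (by positivity) (n : ℝ)]
    have hA : A ≤ √n * ε / Real.exp 1 ^ (M + 1) := by
      rw [le_div_iff₀ (by positivity)]
      linarith
    calc _ ≤ √(2 * Real.pi) * (√n * ε / Real.exp 1 ^ (M + 1)) * (√n ^ (M + 1))⁻¹ := by gcongr
      _ = _ := by field_simp
  have hqp : ∏ i, q i ^ α i / ((α i).factorial : ℝ) =
      E * ∏ i, ((α i : ℝ) / n) ^ α i / (α i).factorial := by
    simp only [Finset.prod_div_distrib, ← hpα]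
    rw [← hexp, mul_div_assoc]
  rw [← mul_assoc, gamma_mul_prod_eq hα hn hn0, hqp]
  calc _ ≤ √(2 * Real.pi * n) / (Real.exp 1 ^ (M + 1) * √n ^ (M + 1)) * ε * E :=
        mul_le_mul_of_nonneg_right hconst (Real.exp_pos _).le
    _ ≤ (n.factorial * ∏ i, ((α i : ℝ) / n) ^ α i / (α i).factorial) * p j * E := by
        gcongr
        exact hpε j
    _ = _ := by
        rw [hpα]
        ring

theorem mainTheorem4 (M : ℕ) (hM : 1 ≤ M) (ε : ℝ) (hε : 0 < ε) :
    ∃ N : ℕ, ∀ (C : Set ℝ), IsCompact C →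
      ∀ (s : Fin (M + 1) → C), Function.Injective s →
      ∀ (r : ℝ) (ρ : RiskFunctional C), IsDominant ρ → HasDominanceCard ρ s r M →
      ∀ (α : Fin (M + 1) → ℕ), (∀ i, 0 < α i) →
      ∀ (n : ℕ), n = ∑ i, α i → N ≤ n →
      ∀ (p : stdSimplex ℝ (Fin (M + 1))), (∀ i, p i = (α i : ℝ) / n) → (∀ i, ε ≤ p i) →
      ∀ {Ω : Type*} [MeasurableSpace Ω] (P : Measure Ω) [IsProbabilityMeasure P]
        (L : Ω → stdSimplex ℝ (Fin (M + 1))),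
        HasLaw (fun ω => (L ω : Fin (M + 1) → ℝ)) (dirichletMeasure fun i => (α i : ℝ)) P →
        ENNReal.ofReal (√(2 * Real.pi) * ((M : ℝ) / 2.13) ^ ((M : ℝ) / 2) *
              (n : ℝ) ^ (-((M : ℝ) + 1) / 2)) *
            EReal.exp (-(((n : ℝ≥0∞) * riskKinf ρ s (discreteLaw s p) r : ℝ≥0∞) : EReal))
          ≤ P {ω | r ≤ simplexRisk ρ s (L ω)} := by
  set B : ℝ := Real.exp 1 ^ (M + 1) * ((M : ℝ) / 2.13) ^ ((M : ℝ) / 2) / ε with hB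
  obtain ⟨N, hN⟩ := exists_nat_ge (B ^ 2)
  refine ⟨N, fun C _ s hs r ρ _ hcard α hα n hn hNn p hpα hpε Ω _ P _ L hL => ?_⟩
  have hn0 : n ≠ 0 := by
    have := (hα 0).trans_le
      (Finset.single_le_sum (fun i _ => Nat.zero_le (α i)) (Finset.mem_univ 0))
    omega
  -- An infinite infimum makes the left side zero; a finite one forces the superlevel set to be
  -- nonempty, so a witness exists.
  by_cases hK : riskKinf ρ s (discreteLaw s p) r = ∞
  · rw [hK, ENNReal.mul_top (by exact_mod_cast hn0)]
    simp
  have hne : (riskSuperlevel ρ s r).Nonempty := by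
    by_contra hemp
    exact hK (by simp [riskKinf, Set.not_nonempty_iff_eq_empty.1 hemp])
  obtain ⟨q, I, hw, hI⟩ := hcard hne p
  obtain ⟨j, hj⟩ : ∃ j, Iᶜ = {j} := Finset.card_eq_one.1 (by simp [Finset.card_compl, hI])
  have hjI (i) : i ∈ I ↔ i ≠ j := by
    rw [← not_iff_not, ← Finset.mem_compl, hj]
    simp
  have hsqrt : B ≤ √n := Real.le_sqrt_of_sq_le (hN.trans (by exact_mod_cast hNn))
  rw [hw.attains] at hK ⊢
  have hmain := le_dirichletMeasure_cone hM hε hs hα hn hsqrt hpα hpε hK j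
  have hsub : {ω | ∀ i, i ≠ j → L ω i ≤ q i} ⊆ {ω | r ≤ simplexRisk ρ s (L ω)} := by
    intro ω hω
    refine hw.feasible.2.trans (hw.cone_subset ⟨L ω, rfl, fun i hi => hω i ((hjI i).1 hi), ?_⟩).2
    -- The lower bound on the free coordinate follows from the upper bounds on the others, as both
    -- vectors sum to one.
    intro i hi
    obtain rfl : i = j := by simpa [hjI] using hi
    have h1 : ∑ k, L ω k = 1 := (L ω).2.2
    have h2 : ∑ k, q k = 1 := q.2.2
    rw [← Finset.add_sum_erase _ _ (Finset.mem_univ i)] at h1 h2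
    have h3 : ∑ k ∈ Finset.univ.erase i, L ω k ≤ ∑ k ∈ Finset.univ.erase i, q k :=
      Finset.sum_le_sum fun k hk => hω k (Finset.ne_of_mem_erase hk)
    linarith
  have hS : MeasurableSet {x : Fin (M + 1) → ℝ | ∀ i, i ≠ j → x i ≤ q i} := by
    simp only [Set.ofPred_forall]
    exact MeasurableSet.iInter fun i => MeasurableSet.iInter fun _ =>
      measurableSet_le (measurable_pi_apply i) measurable_const
  calc _ ≤ dirichletMeasure (fun i => (α i : ℝ)) {x | ∀ i, i ≠ j → x i ≤ q i} := by
        refine le_trans (le_of_eq ?_) hmain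
        rw [ENNReal.ofReal_mul (q := Real.exp _) (by positivity), ← EReal.exp_coe]
        congr 2
        rw [← EReal.coe_ennreal_toReal (ENNReal.mul_ne_top (ENNReal.natCast_ne_top n) hK),
          ENNReal.toReal_mul, ENNReal.toReal_natCast, EReal.coe_neg]
    _ = P {ω | ∀ i, i ≠ j → L ω i ≤ q i} := (hL.measure_eq hS).symm
    _ ≤ _ := measure_mono hsub
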